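/- Let $n$ and $k$ be positive integers, let $K_{2nk}$ be the complete graph on $2nk$ vertices, and let $c\colon E(K_{2nk})\to [k]=\{1,\dots,k\}$ be an edge-colouring that is colour-balanced, meaning that $|c^{-1}(i)|=|c^{-1}(j)|$ for all $i,j\in[k]$. Then there is a perfect matching $M$ of $K_{2nk}$ such that \[ f(M):=\sum_{i=1}^{k}\Bigl|\,|c^{-1}(i)\cap M|-n\,\Bigr|\;\le\;4^{k^2}. \] -/

import Mathlib

/-- An edge-colouring `c` with palette `K` is colour-balanced if every colour of the palette is
used on equally many edges. -/
def IsColourBalanced {V K : Type*} {G : SimpleGraph V} (c : G.edgeSet → K) : Prop :=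
  ∀ i j : K, (c ⁻¹' {i}).ncard = (c ⁻¹' {j}).ncard

/-- The number `|c⁻¹(i) ∩ M|` of edges of colour `i` in the subgraph `M`. -/
noncomputable def colourCount {V K : Type*} {G : SimpleGraph V} (c : G.edgeSet → K)
    (M : G.Subgraph) (i : K) : ℕ :=
  (c ⁻¹' {i} ∩ {e | (e : Sym2 V) ∈ M.edgeSet}).ncard

/-- `f(M) = ∑ i, | |c⁻¹(i) ∩ M| - n |`, computed in the integers. -/
noncomputable def matchingImbalance {V K : Type*} [Fintype K] {G : SimpleGraph V}
    (c : G.edgeSet → K) (n : ℕ) (M : G.Subgraph) : ℤ :=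
  ∑ i : K, |(colourCount c M i : ℤ) - (n : ℤ)|

open Finset

/-! Write k = d + 1. The last colour count is determined by the others, so record a perfect matching
by the vector w ∈ ℤ^d of deviations from n in the first d colours, and choose a matching minimising
‖w‖₁. The imbalance is then at most 2‖w‖₁.

A switch replaces two matching edges by two other edges on the same four vertices and changes w by
an integer vector of ℓ¹-norm at most 4. Colour balance makes the sum of all switch effects a
negative multiple of w (`sum_switchEffect`), so -w is a nonnegative combination of effects. Effects
that a bounded set of edges can block contribute little. Hence -w is close to the cone of the rich
effects, which can be realised repeatedly by disjoint switches.

By Carathéodory the point of the cone is a combination of linearly independent effects, and Cramer's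
rule bounds the coefficients, because a nonzero integer determinant is at least 1 in absolute value.
If w is large, scaling this combination down and rounding its coefficients gives boundedly many rich
effects that shorten w (`exists_list_sum_abs_add_lt`). Performing them as disjoint switches
contradicts minimality, which gives `sum_abs_le_of_switch_minimal`. The resulting bound is small
enough for d ≥ 2; d = 1 uses a single switch. -/

/-! ### Determinants and Cramer's rule -/

/-- The determinant is bounded by the product of the `ℓ¹`-norms of the columns. -/
theorem Matrix.abs_det_le_prod_sum_abs {ι : Type*} [Fintype ι] [DecidableEq ι]
    (A : Matrix ι ι ℝ) : |A.det| ≤ ∏ j, ∑ i, |A i j| := by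
  -- The product of column sums expands over all maps ι → ι; the determinant uses only the bijective
  -- ones.
  rw [Matrix.det_apply', Finset.prod_univ_sum, Fintype.piFinset_univ]
  calc |∑ σ : Equiv.Perm ι, ((Equiv.Perm.sign σ : ℤ) : ℝ) * ∏ i, A (σ i) i|
      ≤ ∑ σ : Equiv.Perm ι, |((Equiv.Perm.sign σ : ℤ) : ℝ) * ∏ i, A (σ i) i| :=
        Finset.abs_sum_le_sum_abs _ _
    _ = ∑ σ : Equiv.Perm ι, ∏ i, |A (σ i) i| := by
        refine Finset.sum_congr rfl fun σ _ => ?_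
        rw [abs_mul, Finset.abs_prod]
        rcases Int.units_eq_one_or (Equiv.Perm.sign σ) with h | h <;> simp [h]
    _ = ∑ p ∈ (univ : Finset (Equiv.Perm ι)).image (fun σ : Equiv.Perm ι => (σ : ι → ι)),
          ∏ i, |A (p i) i| := by
        rw [Finset.sum_image]
        intro σ _ τ _ h
        exact Equiv.coe_fn_injective h
    _ ≤ ∑ p : ι → ι, ∏ i, |A (p i) i| :=
        Finset.sum_le_sum_of_subset_of_nonneg (Finset.subset_univ _)
          fun p _ _ => Finset.prod_nonneg fun i _ => abs_nonneg _

/-- The solution of a nonsingular linear system with an integer matrix whose columns have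
`ℓ¹`-norm at most `4` is bounded in terms of the right-hand side. -/
theorem Matrix.abs_le_pow_mul_sum_abs_mulVec {d : ℕ} (B : Matrix (Fin d) (Fin d) ℤ)
    (hdet : B.det ≠ 0) (hB : ∀ j, ∑ i, |B i j| ≤ 4) (z : Fin d → ℝ) (i : Fin d) :
    |z i| ≤ 4 ^ (d - 1) * ∑ j, |(B.map (Int.cast : ℤ → ℝ)).mulVec z j| := by
  set A := B.map (Int.cast : ℤ → ℝ) with hA
  have hdetA : A.det = (B.det : ℝ) := by
    rw [hA]
    exact ((Int.castRingHom ℝ).map_det B).symm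
  have h1 : (1 : ℝ) ≤ |A.det| := by
    rw [hdetA]
    exact_mod_cast Int.one_le_abs hdet
  -- Cramer's rule.
  have hc : A.det * z i = (A.updateCol i (A.mulVec z)).det := by
    rw [← Matrix.cramer_apply, Matrix.cramer_eq_adjugate_mulVec, Matrix.mulVec_mulVec,
      Matrix.adjugate_mul]
    simp [Matrix.smul_mulVec]
  calc |z i| ≤ |A.det| * |z i| := le_mul_of_one_le_left (abs_nonneg _) h1
    _ = |(A.updateCol i (A.mulVec z)).det| := by rw [← abs_mul, hc]
    _ ≤ ∏ j, ∑ l, |A.updateCol i (A.mulVec z) l j| := Matrix.abs_det_le_prod_sum_abs _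
    _ = (∑ l, |A.mulVec z l|) * ∏ j ∈ univ.erase i, ∑ l, |A l j| := by
        rw [← Finset.mul_prod_erase univ _ (Finset.mem_univ i)]
        congr 1
        · simp
        · refine Finset.prod_congr rfl fun j hj => ?_
          simp [Matrix.updateCol_ne (Finset.ne_of_mem_erase hj)]
    _ ≤ (∑ l, |A.mulVec z l|) * ∏ j ∈ univ.erase i, (4 : ℝ) := by
        refine mul_le_mul_of_nonneg_left ?_ (Finset.sum_nonneg fun l _ => abs_nonneg _)
        refine Finset.prod_le_prod (fun j _ => Finset.sum_nonneg fun l _ => abs_nonneg _) ?_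
        intro j _
        have := hB j
        simp only [hA, Matrix.map_apply]
        exact_mod_cast this
    _ = 4 ^ (d - 1) * ∑ j, |A.mulVec z j| := by
        rw [Finset.prod_const, Finset.card_erase_of_mem (Finset.mem_univ i), Finset.card_univ,
          Fintype.card_fin, mul_comm]

/-- The real vector underlying an integer vector. -/
def realVec {d : ℕ} (v : Fin d → ℤ) : Fin d → ℝ := fun j => (v j : ℝ)

theorem card_le_of_linearIndepOn_realVec {d : ℕ} {s : Finset (Fin d → ℤ)}
    (hs : LinearIndepOn ℝ realVec (s : Set (Fin d → ℤ))) : s.card ≤ d := by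
  have h := LinearIndependent.fintype_card_le_finrank (R := ℝ) (b := fun x : s => realVec x.1) hs
  simpa using h

/-- The coefficients of a combination of linearly independent integer vectors of `ℓ¹`-norm at
most `4` are bounded in terms of the `ℓ¹`-norm of the combination. -/
theorem abs_coeff_le_of_linearIndepOn {d : ℕ} {s : Finset (Fin d → ℤ)}
    (hs : LinearIndepOn ℝ realVec (s : Set (Fin d → ℤ))) (h4 : ∀ v ∈ s, ∑ j, |v j| ≤ 4)
    (lam : (Fin d → ℤ) → ℝ) {v : Fin d → ℤ} (hv : v ∈ s) :
    |lam v| ≤ 4 ^ (d - 1) * ∑ j, |∑ x ∈ s, lam x * (x j : ℝ)| := by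
  classical
  -- Completing to a basis with unit vectors keeps the matrix integral with columns of norm at most
  -- 4; the added vectors get coefficient 0.
  set t : Set (Fin d → ℤ) := (s : Set (Fin d → ℤ)) ∪ Set.range (fun j => Pi.single j (1 : ℤ))
    with ht
  obtain ⟨b, hbt, hsb, hspan, hb⟩ := exists_linearIndepOn_extension hs
    (Set.subset_union_left : (s : Set (Fin d → ℤ)) ⊆ t)
  have htop : ⊤ ≤ Submodule.span ℝ (Set.range fun x : b => realVec x.1) := by
    rw [← (Pi.basisFun ℝ (Fin d)).span_eq, Submodule.span_le]
    rintro _ ⟨j, rfl⟩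
    have h1 : realVec (Pi.single j (1 : ℤ)) ∈ Submodule.span ℝ (realVec '' b) :=
      hspan ⟨_, Or.inr ⟨j, rfl⟩, rfl⟩
    have h2 : realVec (Pi.single j (1 : ℤ)) = Pi.basisFun ℝ (Fin d) j := by
      ext l
      by_cases h : l = j
      · subst h; simp [realVec]
      · simp [realVec, h]
    rw [h2] at h1
    rw [Set.image_eq_range] at h1
    exact h1
  let bas : Module.Basis b ℝ (Fin d → ℝ) := Module.Basis.mk hb htop
  let e : b ≃ Fin d := bas.indexEquiv (Pi.basisFun ℝ (Fin d))
  have : Fintype b := Fintype.ofEquiv _ e.symm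
  let B : Matrix (Fin d) (Fin d) ℤ := Matrix.of fun i j => (e.symm j).1 i
  have hB : ∀ j, ∑ i, |B i j| ≤ 4 := by
    intro j
    rcases hbt (e.symm j).2 with h | ⟨l, h⟩
    · exact h4 _ h
    · simp only [B, Matrix.of_apply, ← h]
      rw [Finset.sum_eq_single l]
      · simp
      · intro i _ hi
        simp [hi]
      · simp
  have hdet : B.det ≠ 0 := by
    have hcol : LinearIndependent ℝ (B.map (Int.cast : ℤ → ℝ)).col :=
      hb.comp e.symm e.symm.injective
    have hu := (Matrix.isUnit_iff_isUnit_det _).1 (Matrix.linearIndependent_cols_iff_isUnit.1 hcol)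
    intro h0
    have : (B.map (Int.cast : ℤ → ℝ)).det = (B.det : ℝ) := ((Int.castRingHom ℝ).map_det B).symm
    rw [this, h0] at hu
    simp at hu
  let z : Fin d → ℝ := fun j => if (e.symm j).1 ∈ s then lam (e.symm j).1 else 0
  have hz := Matrix.abs_le_pow_mul_sum_abs_mulVec B hdet hB z (e ⟨v, hsb hv⟩)
  have hzv : z (e ⟨v, hsb hv⟩) = lam v := by simp [z, hv]
  have hmul : ∀ j, (B.map (Int.cast : ℤ → ℝ)).mulVec z j = ∑ x ∈ s, lam x * (x j : ℝ) := by
    intro j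
    have h1 : (B.map (Int.cast : ℤ → ℝ)).mulVec z j
        = ∑ x : b, (if x.1 ∈ s then lam x.1 * (x.1 j : ℝ) else 0) := by
      rw [← e.symm.sum_comp]
      simp only [Matrix.mulVec, dotProduct, B, z, Matrix.map_apply, Matrix.of_apply]
      refine Finset.sum_congr rfl fun l _ => ?_
      split_ifs <;> ring
    rw [h1, ← Finset.sum_filter]
    refine Finset.sum_bij (fun x _ => x.1) ?_ ?_ ?_ ?_
    · intro x hx; simpa using hx
    · intro x _ y _ h; exact Subtype.ext h
    · intro x hx; exact ⟨⟨x, hsb hx⟩, by simpa using hx, rfl⟩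
    · intro x _; rfl
  rw [hzv] at hz
  simpa only [hmul] using hz

/-! ### Combinations in cones and their rounding -/

/-- Carathéodory's theorem for cones: a nonnegative combination can be rewritten with a linearly
independent support. -/
theorem exists_linearIndepOn_nonneg_combination {ι E : Type*} [AddCommGroup E]
    [Module ℝ E] (f : ι → E) (s : Finset ι) (lam : ι → ℝ) (hlam : ∀ i ∈ s, 0 ≤ lam i) :
    ∃ t ⊆ s, LinearIndepOn ℝ f (t : Set ι) ∧ ∃ mu : ι → ℝ, (∀ i ∈ t, 0 ≤ mu i) ∧
      ∑ i ∈ t, mu i • f i = ∑ i ∈ s, lam i • f i := by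
  classical
  induction s using Finset.strongInduction generalizing lam with
  | H s ih =>
    by_cases hind : LinearIndepOn ℝ f (s : Set ι)
    · exact ⟨s, subset_rfl, hind, lam, hlam, rfl⟩
    have hdep : ∃ g : ι → ℝ, ∑ i ∈ s, g i • f i = 0 ∧ ∃ i ∈ s, 0 < g i := by
      rw [linearIndepOn_finset_iff] at hind
      push Not at hind
      obtain ⟨g, hg, i, hi, hgi⟩ := hind
      rcases lt_or_gt_of_ne hgi with h | h
      · exact ⟨fun i => - g i, by simp [hg], i, hi, by simpa using h⟩
      · exact ⟨g, hg, i, hi, h⟩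
    obtain ⟨g, hg, i₁, hi₁, hgi₁⟩ := hdep
    -- Ratio test: the minimal ratio is the largest multiple of g that can be subtracted with all
    -- coefficients staying nonnegative, and it kills the one at i₀.
    obtain ⟨i₀, hi₀, hmin⟩ := Finset.exists_min_image (s.filter fun i => 0 < g i)
      (fun i => lam i / g i) ⟨i₁, by simp [hi₁, hgi₁]⟩
    simp only [Finset.mem_filter] at hi₀ hmin
    set r := lam i₀ / g i₀ with hr
    have hr0 : 0 ≤ r := div_nonneg (hlam _ hi₀.1) hi₀.2.le
    have hzero : lam i₀ - r * g i₀ = 0 := by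
      rw [hr, div_mul_cancel₀ _ hi₀.2.ne', sub_self]
    obtain ⟨t, hts, ht, mu, hmu, hsum⟩ := ih (s.erase i₀) (Finset.erase_ssubset hi₀.1)
      (fun i => lam i - r * g i) (by
        intro i hi
        have his := Finset.mem_of_mem_erase hi
        rcases le_or_gt (g i) 0 with h | h
        · have := mul_nonneg hr0 (neg_nonneg.2 h)
          have := hlam i his
          linarith
        · have := (le_div_iff₀ h).1 (hmin i ⟨his, h⟩)
          linarith)
    refine ⟨t, hts.trans (Finset.erase_subset _ _), ht, mu, hmu, hsum.trans ?_⟩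
    have h1 : ∑ i ∈ s.erase i₀, (lam i - r * g i) • f i = ∑ i ∈ s, (lam i - r * g i) • f i := by
      rw [← Finset.add_sum_erase s _ hi₀.1, hzero, zero_smul, zero_add]
    rw [h1]
    simp only [sub_smul, mul_smul, Finset.sum_sub_distrib]
    rw [← Finset.smul_sum, hg, smul_zero, sub_zero]

theorem exists_list_of_multiplicities {E : Type*} [AddCommMonoid E] (s : Finset E) (m : E → ℕ) :
    ∃ l : List E, (∀ v ∈ l, v ∈ s) ∧ l.length = ∑ v ∈ s, m v ∧ l.sum = ∑ v ∈ s, m v • v := by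
  classical
  induction s using Finset.induction_on with
  | empty => exact ⟨[], by simp⟩
  | insert a s ha ih =>
    obtain ⟨l, h1, h2, h3⟩ := ih
    refine ⟨List.replicate (m a) a ++ l, ?_, ?_, ?_⟩
    · intro v hv
      rcases List.mem_append.1 hv with h | h
      · simp [List.eq_of_mem_replicate h]
      · exact Finset.mem_insert_of_mem (h1 v h)
    · simp [h2, Finset.sum_insert ha]
    · simp [h3, Finset.sum_insert ha]

/-- If `-w` is close to the cone spanned by short integer vectors, then a bounded number of these
vectors can be added to `w` so as to decrease its `ℓ¹`-norm. -/
theorem exists_list_sum_abs_add_lt {d : ℕ} (hd : 1 ≤ d) (w : Fin d → ℤ)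
    (Q : Finset (Fin d → ℤ)) (hQ : ∀ v ∈ Q, ∑ j, |v j| ≤ 4) (lam : (Fin d → ℤ) → ℝ)
    (hlam : ∀ v ∈ Q, 0 ≤ lam v) (E : ℝ)
    (hE : ∑ j, |(w j : ℝ) + ∑ v ∈ Q, lam v * (v j : ℝ)| ≤ E)
    (hgE : 2 * E < ∑ j, |(w j : ℝ)|) (hgd : 8 * (d : ℝ) ≤ ∑ j, |(w j : ℝ)|) :
    ∃ l : List (Fin d → ℤ), (∀ v ∈ l, v ∈ Q) ∧ l.length ≤ 3 * d ^ 2 * 4 ^ d ∧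
      ∑ j, |w j + l.sum j| < ∑ j, |w j| := by
  obtain ⟨t, htQ, hind, mu, hmu, hsum⟩ :=
    exists_linearIndepOn_nonneg_combination realVec Q lam hlam
  have hsum' : ∀ j, ∑ v ∈ t, mu v * (v j : ℝ) = ∑ v ∈ Q, lam v * (v j : ℝ) := by
    intro j
    have := congrFun hsum j
    simpa [Finset.sum_apply, realVec] using this
  have hcard : (t.card : ℝ) ≤ d := by exact_mod_cast card_le_of_linearIndepOn_realVec hind
  have hd' : (1 : ℝ) ≤ d := by exact_mod_cast hd
  set g : ℝ := ∑ j, |(w j : ℝ)| with hg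
  have hgpos : 0 < g := by linarith
  set u : Fin d → ℝ := fun j => ∑ v ∈ t, mu v * (v j : ℝ) with hu
  set err : Fin d → ℝ := fun j => (w j : ℝ) + u j with herr
  have hErr : ∑ j, |err j| ≤ E := by
    simpa only [herr, hu, hsum'] using hE
  have hunorm : ∑ j, |u j| ≤ 3 / 2 * g := by
    have : ∑ j, |u j| ≤ ∑ j, (|err j| + |(w j : ℝ)|) := by
      refine Finset.sum_le_sum fun j _ => ?_
      have : u j = err j - w j := by simp [herr]
      rw [this]
      exact abs_sub _ _
    rw [Finset.sum_add_distrib] at this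
    linarith
  have hmuB : ∀ v ∈ t, mu v ≤ 4 ^ (d - 1) * (3 / 2 * g) := by
    intro v hv
    have := abs_coeff_le_of_linearIndepOn hind (fun v hv => hQ v (htQ hv)) mu hv
    refine (le_abs_self _).trans (this.trans ?_)
    gcongr
  -- With r * g = 8d, scaling gains more than r * g / 2 = 4d, while rounding down at most d
  -- coefficients costs at most 4d.
  set r : ℝ := 8 * d / g with hr
  have hr0 : 0 ≤ r := by positivity
  have hr1 : r ≤ 1 := by rw [hr, div_le_one hgpos]; exact hgd
  have hrg : r * g = 8 * d := by rw [hr, div_mul_cancel₀ _ hgpos.ne']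
  obtain ⟨l, hlt, hlen, hlsum⟩ := exists_list_of_multiplicities t (fun v => ⌊r * mu v⌋₊)
  refine ⟨l, fun v hv => htQ (hlt v hv), ?_, ?_⟩
  · have h1 : (l.length : ℝ) ≤ 3 * d ^ 2 * 4 ^ d := by
      rw [hlen]
      push_cast
      calc ∑ v ∈ t, (⌊r * mu v⌋₊ : ℝ) ≤ ∑ v ∈ t, r * (4 ^ (d - 1) * (3 / 2 * g)) := by
            refine Finset.sum_le_sum fun v hv => ?_
            refine (Nat.floor_le (mul_nonneg hr0 (hmu v hv))).trans ?_
            exact mul_le_mul_of_nonneg_left (hmuB v hv) hr0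
        _ = t.card * (12 * d * 4 ^ (d - 1)) := by
            rw [Finset.sum_const, nsmul_eq_mul]
            linear_combination (t.card : ℝ) * 4 ^ (d - 1) * (3 / 2) * hrg
        _ ≤ d * (12 * d * 4 ^ (d - 1)) := by gcongr
        _ = 3 * d ^ 2 * 4 ^ d := by
            obtain ⟨e, rfl⟩ : ∃ e, d = e + 1 := ⟨d - 1, by omega⟩
            simp only [Nat.add_sub_cancel, pow_succ]
            ring
    exact_mod_cast h1
  · set rho : Fin d → ℝ := fun j => ∑ v ∈ t, (r * mu v - ⌊r * mu v⌋₊) * (v j : ℝ) with hrho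
    have hls : ∀ j, ((l.sum j : ℤ) : ℝ) = r * u j - rho j := by
      intro j
      rw [hlsum]
      simp only [hrho, hu, Finset.sum_apply, Int.cast_sum, Finset.mul_sum,
        ← Finset.sum_sub_distrib]
      refine Finset.sum_congr rfl fun v _ => ?_
      rw [Pi.smul_apply, nsmul_eq_mul]
      push_cast
      ring
    have hrhoN : ∑ j, |rho j| ≤ 4 * d := by
      calc ∑ j, |rho j| ≤ ∑ j, ∑ v ∈ t, |(v j : ℝ)| := by
            refine Finset.sum_le_sum fun j _ => (Finset.abs_sum_le_sum_abs _ _).trans ?_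
            refine Finset.sum_le_sum fun v hv => ?_
            rw [abs_mul]
            refine mul_le_of_le_one_left (abs_nonneg _) ?_
            have h1 := Nat.floor_le (mul_nonneg hr0 (hmu v hv))
            have h2 := Nat.lt_floor_add_one (r * mu v)
            rw [abs_le]
            constructor <;> linarith
        _ = ∑ v ∈ t, ∑ j, |(v j : ℝ)| := Finset.sum_comm
        _ ≤ ∑ v ∈ t, (4 : ℝ) := by
            refine Finset.sum_le_sum fun v hv => ?_
            exact_mod_cast hQ v (htQ hv)
        _ ≤ 4 * d := by
            rw [Finset.sum_const, nsmul_eq_mul]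
            linarith
    have hmain : ∑ j, |(w j : ℝ) + ((l.sum j : ℤ) : ℝ)| < g := by
      calc ∑ j, |(w j : ℝ) + ((l.sum j : ℤ) : ℝ)|
          ≤ ∑ j, ((1 - r) * |(w j : ℝ)| + r * |err j| + |rho j|) := by
            refine Finset.sum_le_sum fun j _ => ?_
            have : (w j : ℝ) + ((l.sum j : ℤ) : ℝ) = (1 - r) * w j + r * err j - rho j := by
              rw [hls]; simp only [herr]; ring
            rw [this]
            refine (abs_sub _ _).trans (add_le_add_left ?_ _)
            refine (abs_add_le _ _).trans ?_
            rw [abs_mul, abs_mul, abs_of_nonneg hr0, abs_of_nonneg (sub_nonneg.2 hr1)]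
        _ = (1 - r) * g + r * ∑ j, |err j| + ∑ j, |rho j| := by
            rw [Finset.sum_add_distrib, Finset.sum_add_distrib, ← Finset.mul_sum,
              ← Finset.mul_sum]
        _ < g := by
            have h1 : r * ∑ j, |err j| < r * (g / 2) := by
              refine mul_lt_mul_of_pos_left (by linarith) ?_
              positivity
            nlinarith
    have : ((∑ j, |w j + l.sum j| : ℤ) : ℝ) < ((∑ j, |w j| : ℤ) : ℝ) := by
      push_cast
      exact hmain
    exact_mod_cast this

/-! ### Abstract switches and richness -/

/-- A switch `(i, j, b)` joins the first end of edge `i` to the end `b` of edge `j`; two switches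
are disjoint if they involve no common edge. -/
def SwitchDisjoint {I : Type*} (σ τ : I × I × Bool) : Prop :=
  σ.1 ≠ τ.1 ∧ σ.1 ≠ τ.2.1 ∧ σ.2.1 ≠ τ.1 ∧ σ.2.1 ≠ τ.2.1

/-- A list of proper, pairwise disjoint switches. -/
def IsSwitchFamily {I : Type*} (l : List (I × I × Bool)) : Prop :=
  (∀ σ ∈ l, σ.1 ≠ σ.2.1) ∧ l.Pairwise SwitchDisjoint

/-- A value `v` is rich if fewer than `2 * L` edges never meet all switches of effect `v`. -/
def IsRich {I E : Type*} (Φ : I × I × Bool → E) (L : ℕ) (v : E) : Prop :=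
  ∀ A : Finset I, A.card < 2 * L → ∃ σ : I × I × Bool, σ.1 ≠ σ.2.1 ∧ Φ σ = v ∧ σ.1 ∉ A ∧ σ.2.1 ∉ A

/-- Greedy choice: the switches already chosen number at most L - 1, so they occupy fewer than 2L
edges, which richness allows one to avoid. -/
theorem exists_switchFamily_of_isRich {I E : Type*} [DecidableEq I] (Φ : I × I × Bool → E) (L : ℕ)
    (l : List E) (hl : ∀ v ∈ l, IsRich Φ L v) (hlen : l.length ≤ L) :
    ∃ s : List (I × I × Bool), IsSwitchFamily s ∧ s.map Φ = l := by
  induction l with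
  | nil => exact ⟨[], ⟨by simp, List.Pairwise.nil⟩, rfl⟩
  | cons v l ih =>
    rw [List.length_cons] at hlen
    obtain ⟨s, ⟨hs1, hs2⟩, hs⟩ := ih (fun v hv => hl v (List.mem_cons_of_mem _ hv)) (by omega)
    have hsl : s.length = l.length := by rw [← hs, List.length_map]
    set A : Finset I := (s.map fun σ => σ.1).toFinset ∪ (s.map fun σ => σ.2.1).toFinset with hA
    have hAc : A.card < 2 * L := by
      have h1 := Finset.card_union_le (s.map fun σ => σ.1).toFinset (s.map fun σ => σ.2.1).toFinset
      have h2 := List.toFinset_card_le (s.map fun σ => σ.1)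
      have h3 := List.toFinset_card_le (s.map fun σ => σ.2.1)
      rw [List.length_map] at h2 h3
      rw [← hA] at h1
      omega
    obtain ⟨σ, h1, h2, h3, h4⟩ := hl v (by simp) A hAc
    simp only [hA, Finset.mem_union, List.mem_toFinset, List.mem_map, not_or, not_exists,
      not_and] at h3 h4
    refine ⟨σ :: s, ⟨?_, ?_⟩, by simp [h2, hs]⟩
    · intro τ hτ
      rcases List.mem_cons.1 hτ with rfl | h
      · exact h1
      · exact hs1 τ h
    · refine List.Pairwise.cons (fun τ hτ => ?_) hs2
      exact ⟨Ne.symm (h3.1 τ hτ), Ne.symm (h3.2 τ hτ), Ne.symm (h4.1 τ hτ), Ne.symm (h4.2 τ hτ)⟩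

/-- A given edge can be the first or the second of the switch, with at most |I| - 1 partners and two
choices of end. -/
theorem card_switches_meeting_le {I : Type*} [Fintype I] [DecidableEq I] (A : Finset I)
    (s : Finset (I × I × Bool))
    (hs : ∀ σ ∈ s, σ.1 ≠ σ.2.1 ∧ (σ.1 ∈ A ∨ σ.2.1 ∈ A)) :
    s.card ≤ A.card * (4 * (Fintype.card I - 1)) := by
  let F : I → Finset (I × I × Bool) := fun a =>
    ((univ.erase a) ×ˢ (univ : Finset Bool)).image (fun p => (a, p.1, p.2)) ∪
      ((univ.erase a) ×ˢ (univ : Finset Bool)).image (fun p => (p.1, a, p.2))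
  have hsub : s ⊆ A.biUnion F := by
    rintro ⟨i, j, b⟩ hσ
    obtain ⟨hne, h⟩ := hs _ hσ
    simp only at hne h
    simp only [F, Finset.mem_biUnion, Finset.mem_union, Finset.mem_image, Finset.mem_product,
      Finset.mem_erase, Finset.mem_univ, and_true, Prod.exists, Prod.mk.injEq]
    rcases h with h | h
    · exact ⟨i, h, Or.inl ⟨j, b, hne.symm, rfl, rfl, rfl⟩⟩
    · exact ⟨j, h, Or.inr ⟨i, b, hne, rfl, rfl, rfl⟩⟩
  refine (Finset.card_le_card hsub).trans (Finset.card_biUnion_le_card_mul _ _ _ fun a _ => ?_)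
  have hc : ((univ.erase a) ×ˢ (univ : Finset Bool)).card = 2 * (Fintype.card I - 1) := by
    rw [Finset.card_product, Finset.card_erase_of_mem (Finset.mem_univ a), Finset.card_univ,
      Finset.card_univ, Fintype.card_bool, mul_comm]
  refine (Finset.card_union_le _ _).trans ?_
  have h1 := Finset.card_image_le (s := (univ.erase a) ×ˢ (univ : Finset Bool))
    (f := fun p : I × Bool => (a, p.1, p.2))
  have h2 := Finset.card_image_le (s := (univ.erase a) ×ˢ (univ : Finset Bool))
    (f := fun p : I × Bool => (p.1, a, p.2))
  omega

/-- If no family of disjoint switches decreases the `ℓ¹`-norm of `w`, and the switches average to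
a negative multiple of `w`, then `w` is bounded. -/
theorem sum_abs_le_of_switch_minimal {I : Type*} [Fintype I] [DecidableEq I] [Nonempty I] {d : ℕ}
    (hd : 1 ≤ d) (Φ : I × I × Bool → Fin d → ℤ) (w : Fin d → ℤ)
    (h4 : ∀ σ, ∑ j, |Φ σ j| ≤ 4) (h2 : ∀ σ j, |Φ σ j| ≤ 2)
    (hsum : ∀ j, ∑ σ : I × I × Bool with σ.1 ≠ σ.2.1, Φ σ j
      = -(2 * (2 * (Fintype.card I : ℤ) - 1)) * w j)
    (hmin : ∀ s : List (I × I × Bool), IsSwitchFamily s →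
      ∑ j, |w j| ≤ ∑ j, |w j + (s.map Φ).sum j|) :
    ∑ j, |w j| ≤ 48 * d ^ 2 * 20 ^ d := by
  classical
  by_contra! hcon
  -- The length bound of `exists_list_sum_abs_add_lt`.
  set L : ℕ := 3 * d ^ 2 * 4 ^ d with hL
  set S : Finset (I × I × Bool) := univ.filter fun σ => σ.1 ≠ σ.2.1 with hS
  set T : Finset (Fin d → ℤ) := Fintype.piFinset fun _ => Finset.Icc (-2) 2 with hT
  have hTcard : T.card = 5 ^ d := by simp [hT]
  have hΦT : ∀ σ, Φ σ ∈ T := by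
    intro σ
    simp only [hT, Fintype.mem_piFinset, Finset.mem_Icc]
    exact fun j => abs_le.1 (h2 σ j)
  set Q : Finset (Fin d → ℤ) := (S.image Φ).filter (IsRich Φ L) with hQ
  set P : Finset (I × I × Bool) := S.filter fun σ => ¬ IsRich Φ L (Φ σ) with hP
  set m : ℕ := Fintype.card I with hm
  have hm1 : 1 ≤ m := Fintype.card_pos
  have hm1' : (1 : ℝ) ≤ m := by exact_mod_cast hm1
  -- All switches of a non-rich value meet a set of fewer than 2L edges, and the box [-2, 2]^d
  -- contains 5^d values.
  have hPcard : P.card ≤ (2 * L) * (4 * (m - 1)) * 5 ^ d := by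
    rw [← hTcard]
    refine Finset.card_le_mul_card_image_of_maps_to (f := Φ) (fun σ _ => hΦT σ) _ fun v _ => ?_
    by_cases hv : IsRich Φ L v
    · have : P.filter (fun σ => Φ σ = v) = ∅ := by
        refine Finset.filter_eq_empty_iff.2 fun σ hσ h => ?_
        exact (Finset.mem_filter.1 hσ).2 (h ▸ hv)
      simp [this]
    · unfold IsRich at hv
      push Not at hv
      obtain ⟨A, hA, hAv⟩ := hv
      refine (card_switches_meeting_le A _ fun σ hσ => ?_).trans
        (Nat.mul_le_mul_right _ hA.le)
      simp only [hP, hS, Finset.mem_filter, Finset.mem_univ, true_and] at hσ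
      refine ⟨hσ.1.1, ?_⟩
      by_contra! h
      exact h.2 (hAv σ hσ.1.1 hσ.2 h.1)
  set N : ℝ := 2 * (2 * m - 1) with hN
  have hNpos : 0 < N := by rw [hN]; linarith
  set lam : (Fin d → ℤ) → ℝ := fun v => ((S.filter fun σ => Φ σ = v).card : ℝ) / N with hlam
  have hdecomp : ∀ j, (w j : ℝ) + ∑ v ∈ Q, lam v * (v j : ℝ) = -(∑ σ ∈ P, (Φ σ j : ℝ)) / N := by
    intro j
    have e1 : ∑ σ ∈ S, (Φ σ j : ℝ) = -N * w j := by
      have := congrArg (Int.cast : ℤ → ℝ) (hsum j)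
      push_cast at this
      rw [hN]
      exact this
    have e2 : ∑ σ ∈ S with IsRich Φ L (Φ σ), (Φ σ j : ℝ) + ∑ σ ∈ P, (Φ σ j : ℝ)
        = ∑ σ ∈ S, (Φ σ j : ℝ) := Finset.sum_filter_add_sum_filter_not _ _ _
    have e3 : ∑ σ ∈ S with IsRich Φ L (Φ σ), (Φ σ j : ℝ) = N * ∑ v ∈ Q, lam v * (v j : ℝ) := by
      rw [← Finset.sum_fiberwise_of_maps_to (t := Q) (g := Φ), Finset.mul_sum]
      · refine Finset.sum_congr rfl fun v hv => ?_
        have hv' : IsRich Φ L v := (Finset.mem_filter.1 hv).2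
        have : (S.filter fun σ => IsRich Φ L (Φ σ)).filter (fun σ => Φ σ = v)
            = S.filter fun σ => Φ σ = v := by
          ext σ
          simp only [Finset.mem_filter]
          constructor
          · exact fun h => ⟨h.1.1, h.2⟩
          · exact fun h => ⟨⟨h.1, h.2 ▸ hv'⟩, h.2⟩
        rw [this, Finset.sum_congr rfl (g := fun _ => (v j : ℝ)), Finset.sum_const, nsmul_eq_mul]
        · simp only [hlam]
          field_simp
        · intro σ hσ
          rw [(Finset.mem_filter.1 hσ).2]
      · intro σ hσ
        have := Finset.mem_filter.1 hσ
        exact Finset.mem_filter.2 ⟨Finset.mem_image_of_mem _ this.1, this.2⟩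
    rw [eq_div_iff hNpos.ne']
    linarith
  -- The factor m - 1 in the count of poor switches cancels against N, so the error does not depend
  -- on the number of edges. Twice this error is exactly 48 d² 20^d.
  have hE : ∑ j, |(w j : ℝ) + ∑ v ∈ Q, lam v * (v j : ℝ)| ≤ 8 * L * 5 ^ d := by
    calc ∑ j, |(w j : ℝ) + ∑ v ∈ Q, lam v * (v j : ℝ)|
        ≤ ∑ j, (∑ σ ∈ P, |(Φ σ j : ℝ)|) / N := by
          refine Finset.sum_le_sum fun j _ => ?_
          rw [hdecomp, abs_div, abs_neg, abs_of_pos hNpos]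
          gcongr
          exact Finset.abs_sum_le_sum_abs _ _
      _ = (∑ σ ∈ P, ∑ j, |(Φ σ j : ℝ)|) / N := by
          rw [← Finset.sum_div, Finset.sum_comm]
      _ ≤ (∑ σ ∈ P, (4 : ℝ)) / N := by
          gcongr with σ hσ
          exact_mod_cast h4 σ
      _ ≤ 8 * L * 5 ^ d := by
          rw [div_le_iff₀ hNpos, Finset.sum_const, nsmul_eq_mul]
          have h : (P.card : ℝ) ≤ (2 * L) * (4 * (m - 1)) * 5 ^ d := by
            have := (Nat.cast_le (α := ℝ)).2 hPcard
            push_cast [Nat.cast_sub hm1] at this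
            exact this
          have h0 : (0 : ℝ) ≤ L * 5 ^ d := by positivity
          rw [hN]
          nlinarith
  have hgE : (48 * d ^ 2 * 20 ^ d : ℝ) < ∑ j, |(w j : ℝ)| := by exact_mod_cast hcon
  have h20 : (20 : ℝ) ^ d = 4 ^ d * 5 ^ d := by rw [← mul_pow]; norm_num
  have hd' : (1 : ℝ) ≤ d := by exact_mod_cast hd
  obtain ⟨l, hl, hlen, hlt⟩ := exists_list_sum_abs_add_lt hd w Q (by
      intro v hv
      obtain ⟨σ, _, rfl⟩ := Finset.mem_image.1 (Finset.mem_filter.1 hv).1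
      exact h4 σ) lam (fun v _ => by positivity) _ hE (by
      refine lt_of_eq_of_lt ?_ hgE
      rw [hL, h20]
      push_cast
      ring) (by
      refine le_trans ?_ hgE.le
      have h1 : (1 : ℝ) ≤ 20 ^ d := one_le_pow₀ (by norm_num)
      have h3 : (d : ℝ) ≤ d ^ 2 := by nlinarith
      nlinarith)
  obtain ⟨s, hs, rfl⟩ := exists_switchFamily_of_isRich Φ L l
    (fun v hv => (Finset.mem_filter.1 (hl v hv)).2) hlen
  exact absurd (hmin s hs) (not_le.2 hlt)

/-- The one-dimensional case with a sharp bound. -/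
theorem abs_le_one_of_switch_minimal {I : Type*} [Fintype I] [Nonempty I] [DecidableEq I]
    (φ : I × I × Bool → ℤ) (w : ℤ) (h2 : ∀ σ, |φ σ| ≤ 2)
    (hsum : ∑ σ : I × I × Bool with σ.1 ≠ σ.2.1, φ σ
      = -(2 * (2 * (Fintype.card I : ℤ) - 1)) * w)
    (hmin : ∀ σ : I × I × Bool, σ.1 ≠ σ.2.1 → |w| ≤ |w + φ σ|) : |w| ≤ 1 := by
  have hm1 : (1 : ℤ) ≤ Fintype.card I := by exact_mod_cast (Fintype.card_pos : 0 < Fintype.card I)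
  by_contra! hw
  rcases le_or_gt 0 w with h0 | h0
  · rw [abs_of_nonneg h0] at hw
    have hneg : ∑ σ : I × I × Bool with σ.1 ≠ σ.2.1, φ σ < 0 := by
      rw [hsum]; nlinarith
    -- Some switch decreases w, by at most 2, so w ≥ 2 stays nonnegative and its absolute value
    -- drops.
    obtain ⟨σ, hσ, hlt⟩ := Finset.exists_lt_of_sum_lt
      (g := fun _ => (0 : ℤ)) (by simpa using hneg)
    have h := hmin σ (Finset.mem_filter.1 hσ).2
    have := abs_le.1 (h2 σ)
    rw [abs_of_nonneg h0, abs_of_nonneg (by omega)] at h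
    omega
  · rw [abs_of_neg h0] at hw
    have hpos : 0 < ∑ σ : I × I × Bool with σ.1 ≠ σ.2.1, φ σ := by
      rw [hsum]; nlinarith
    obtain ⟨σ, hσ, hlt⟩ := Finset.exists_lt_of_sum_lt
      (f := fun _ => (0 : ℤ)) (by simpa using hpos)
    have h := hmin σ (Finset.mem_filter.1 hσ).2
    have := abs_le.1 (h2 σ)
    rw [abs_of_neg h0, abs_of_nonpos (by omega)] at h
    omega

/-! ### Switching labelled matchings -/

section Switching

variable {I V K : Type*} [Fintype I] [DecidableEq I]

/-- The total weight, in coordinate `a`, of the edges of the matching labelled by `π`. -/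
def labelledCount (e : V → V → K → ℤ) (π : I × Bool ≃ V) (a : K) : ℤ :=
  ∑ i, e (π (i, false)) (π (i, true)) a

/-- The change of the weights caused by the switch that replaces the edges `i` and `j` by the edge
from the first end of `i` to the end `b` of `j` and the edge joining the two remaining ends. -/
def switchEffect (e : V → V → K → ℤ) (π : I × Bool ≃ V) (σ : I × I × Bool) (a : K) : ℤ :=
  e (π (σ.1, false)) (π (σ.2.1, σ.2.2)) a + e (π (σ.1, true)) (π (σ.2.1, !σ.2.2)) a
    - e (π (σ.1, false)) (π (σ.1, true)) a - e (π (σ.2.1, false)) (π (σ.2.1, true)) a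

/-- Transposing the labels (i, true) and (j, b) performs the switch. Leaving all other edges fixed
is what lets disjoint switches be composed. -/
theorem exists_labelledCount_switch (e : V → V → K → ℤ) (hsymm : ∀ p q a, e p q a = e q p a)
    (π : I × Bool ≃ V) (σ : I × I × Bool) (hσ : σ.1 ≠ σ.2.1) :
    ∃ π' : I × Bool ≃ V, (∀ i, i ≠ σ.1 → i ≠ σ.2.1 → ∀ b, π' (i, b) = π (i, b)) ∧
      ∀ a, labelledCount e π' a = labelledCount e π a + switchEffect e π σ a := by
  obtain ⟨i, j, b⟩ := σ
  simp only at hσ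
  have hfix : ∀ l, l ≠ i → l ≠ j → ∀ c,
      ((Equiv.swap (i, true) (j, b)).trans π) (l, c) = π (l, c) := by
    intro l h1 h2 c
    rw [Equiv.trans_apply, Equiv.swap_apply_of_ne_of_ne] <;> simp [h1, h2]
  refine ⟨(Equiv.swap (i, true) (j, b)).trans π, hfix, fun a => ?_⟩
  set π' := (Equiv.swap (i, true) (j, b)).trans π with hπ'
  have e1 : π' (i, false) = π (i, false) := by
    rw [hπ', Equiv.trans_apply, Equiv.swap_apply_of_ne_of_ne] <;> simp [hσ]
  have e2 : π' (i, true) = π (j, b) := by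
    rw [hπ', Equiv.trans_apply, Equiv.swap_apply_left]
  have e3 : π' (j, b) = π (i, true) := by
    rw [hπ', Equiv.trans_apply, Equiv.swap_apply_right]
  have e4 : π' (j, !b) = π (j, !b) := by
    rw [hπ', Equiv.trans_apply, Equiv.swap_apply_of_ne_of_ne] <;> simp [hσ.symm]
  -- For b = true the new edge appears with its ends reversed, hence the use of symmetry.
  have hj : e (π' (j, false)) (π' (j, true)) a = e (π (i, true)) (π (j, !b)) a := by
    cases b
    · rw [e3, Bool.not_false] at *
      rw [e4]
    · simp only [Bool.not_true] at *
      rw [e3, e4, hsymm]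
  have hsplit : ∀ ρ : I × Bool ≃ V, labelledCount e ρ a = e (ρ (i, false)) (ρ (i, true)) a
      + (e (ρ (j, false)) (ρ (j, true)) a
        + ∑ l ∈ (univ.erase i).erase j, e (ρ (l, false)) (ρ (l, true)) a) := by
    intro ρ
    have hji : j ∈ (univ : Finset I).erase i := by simp [hσ.symm]
    rw [Finset.add_sum_erase _ (fun l => e (ρ (l, false)) (ρ (l, true)) a) hji,
      Finset.add_sum_erase _ (fun l => e (ρ (l, false)) (ρ (l, true)) a) (Finset.mem_univ i)]
    rfl
  have hrest : ∑ l ∈ (univ.erase i).erase j, e (π' (l, false)) (π' (l, true)) a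
      = ∑ l ∈ (univ.erase i).erase j, e (π (l, false)) (π (l, true)) a := by
    refine Finset.sum_congr rfl fun l hl => ?_
    simp only [Finset.mem_erase, Finset.mem_univ, and_true] at hl
    rw [hfix l hl.2 hl.1, hfix l hl.2 hl.1]
  rw [hsplit π', hsplit π, hj, e1, e2, hrest]
  simp only [switchEffect]
  ring

/-- Pairwise disjoint switches can be carried out simultaneously. -/
theorem exists_labelledCount_switchFamily (e : V → V → K → ℤ)
    (hsymm : ∀ p q a, e p q a = e q p a) (π : I × Bool ≃ V) (s : List (I × I × Bool))
    (hs : IsSwitchFamily s) :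
    ∃ π' : I × Bool ≃ V,
      (∀ i, (∀ σ ∈ s, i ≠ σ.1 ∧ i ≠ σ.2.1) → ∀ b, π' (i, b) = π (i, b)) ∧
      ∀ a, labelledCount e π' a = labelledCount e π a + (s.map (switchEffect e π)).sum a := by
  induction s with
  | nil => exact ⟨π, by simp, by simp⟩
  | cons σ s ih =>
    obtain ⟨h1, h2⟩ := hs
    rw [List.pairwise_cons] at h2
    obtain ⟨ρ, hρ, hcount⟩ := ih ⟨fun τ hτ => h1 τ (List.mem_cons_of_mem _ hτ), h2.2⟩
    obtain ⟨ρ', hρ', hcount'⟩ := exists_labelledCount_switch e hsymm ρ σ (h1 σ (by simp))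
    have hi : ∀ b, ρ (σ.1, b) = π (σ.1, b) :=
      hρ _ fun τ hτ => ⟨(h2.1 τ hτ).1, (h2.1 τ hτ).2.1⟩
    have hj : ∀ b, ρ (σ.2.1, b) = π (σ.2.1, b) :=
      hρ _ fun τ hτ => ⟨(h2.1 τ hτ).2.2.1, (h2.1 τ hτ).2.2.2⟩
    refine ⟨ρ', fun i hi' b => ?_, fun a => ?_⟩
    · have hσ := hi' σ (by simp)
      rw [hρ' i hσ.1 hσ.2, hρ i fun τ hτ => hi' τ (List.mem_cons_of_mem _ hτ)]
    · have hE : switchEffect e ρ σ a = switchEffect e π σ a := by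
        simp only [switchEffect, hi, hj]
      rw [hcount', hcount, hE, List.map_cons, List.sum_cons, Pi.add_apply]
      ring

/-- The switches of a labelled matching, summed up. -/
theorem sum_switchEffect [Fintype V] (e : V → V → K → ℤ) (hsymm : ∀ p q a, e p q a = e q p a)
    (hdiag : ∀ p a, e p p a = 0) (π : I × Bool ≃ V) (a : K) :
    ∑ σ : I × I × Bool with σ.1 ≠ σ.2.1, switchEffect e π σ a
      = (∑ p, ∑ q, e p q a) - (4 * (Fintype.card I : ℤ) - 2) * labelledCount e π a := by
  set x : I → ℤ := fun i => e (π (i, false)) (π (i, true)) a with hx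
  set y : I → I → ℤ := fun i j => ∑ b : Bool, ∑ b' : Bool, e (π (i, b)) (π (j, b')) a with hy
  have hyd : ∀ i, y i i = 2 * x i := by
    intro i
    simp only [hy, hx, Fintype.sum_bool, hdiag, hsymm (π (i, true)) (π (i, false))]
    ring
  -- The two values of b together use each of the four pairs between edges i and j exactly once.
  have hσ : ∀ i j, ∑ b : Bool, switchEffect e π (i, j, b) a = y i j - 2 * x i - 2 * x j := by
    intro i j
    simp only [switchEffect, hy, hx, Fintype.sum_bool, Bool.not_true, Bool.not_false]
    ring
  have htot : ∑ p, ∑ q, e p q a = ∑ i, ∑ j, y i j := by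
    have h1 : ∑ p, ∑ q, e p q a = ∑ α : I × Bool, ∑ β : I × Bool, e (π α) (π β) a := by
      rw [← π.sum_comp]
      refine Finset.sum_congr rfl fun α _ => ?_
      rw [← π.sum_comp]
    rw [h1, Fintype.sum_prod_type]
    refine Finset.sum_congr rfl fun i _ => ?_
    simp only [Fintype.sum_prod_type, hy]
    rw [Finset.sum_comm]
  have hcount : labelledCount e π a = ∑ i, x i := rfl
  rw [Finset.sum_filter, Fintype.sum_prod_type]
  have hrow : ∀ i, ∑ τ : I × Bool, (if (i, τ).1 ≠ (i, τ).2.1 then switchEffect e π (i, τ) a else 0)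
      = ∑ j, (if i = j then 0 else (y i j - 2 * x i - 2 * x j)) := by
    intro i
    rw [Fintype.sum_prod_type]
    refine Finset.sum_congr rfl fun j _ => ?_
    by_cases h : i = j
    · simp [h]
    · simp only [ne_eq, h, not_false_eq_true, if_true, if_false]
      exact hσ i j
  -- The omitted diagonal term is 2x - 2x - 2x = -2x; this turns the factor 4m into 4m - 2, where m
  -- is the number of edges.
  have hrow' : ∀ i, ∑ j, (if i = j then 0 else (y i j - 2 * x i - 2 * x j))
      = ∑ j, (y i j - 2 * x i - 2 * x j) + 2 * x i := by
    intro i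
    have : ∀ j, (if i = j then 0 else (y i j - 2 * x i - 2 * x j))
        = (y i j - 2 * x i - 2 * x j) + (if i = j then 2 * x j else 0) := by
      intro j
      split_ifs with h
      · subst h; rw [hyd]; ring
      · ring
    simp only [this, Finset.sum_add_distrib, Finset.sum_ite_eq, Finset.mem_univ, if_true]
  rw [Finset.sum_congr rfl fun i _ => (hrow i).trans (hrow' i), htot, hcount]
  simp only [Finset.sum_add_distrib, Finset.sum_sub_distrib, ← Finset.mul_sum, Finset.sum_const,
    Finset.card_univ, nsmul_eq_mul]
  ring

end Switching

/-! ### Colour counts of matchings -/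

section Colouring

variable {V K : Type*}

/-- The graph formed by the edges of colour `a`. -/
def colourGraph (c : (⊤ : SimpleGraph V).edgeSet → K) (a : K) : SimpleGraph V :=
  SimpleGraph.fromEdgeSet (Subtype.val '' (c ⁻¹' {a}))

theorem colourGraph_adj (c : (⊤ : SimpleGraph V).edgeSet → K) (a : K) {p q : V} (h : p ≠ q) :
    (colourGraph c a).Adj p q ↔ c ⟨s(p, q), (SimpleGraph.mem_edgeSet _).2 h⟩ = a := by
  simp only [colourGraph, SimpleGraph.fromEdgeSet_adj]
  constructor
  · rintro ⟨⟨x, hx, hxs⟩, -⟩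
    have : x = ⟨s(p, q), (SimpleGraph.mem_edgeSet _).2 h⟩ := Subtype.ext hxs
    rw [← this]
    exact hx
  · exact fun hc => ⟨⟨_, hc, rfl⟩, h⟩

theorem colourGraph_edgeSet (c : (⊤ : SimpleGraph V).edgeSet → K) (a : K) :
    (colourGraph c a).edgeSet = Subtype.val '' (c ⁻¹' {a}) := by
  rw [colourGraph, SimpleGraph.edgeSet_fromEdgeSet, sdiff_eq_left, Set.disjoint_left]
  rintro _ ⟨x, -, rfl⟩ hx
  exact SimpleGraph.not_isDiag_of_mem_edgeSet _ x.2 hx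

open Classical in
/-- The indicator of the event that `p` and `q` are joined by an edge of colour `a`. -/
noncomputable def colourIndicator (c : (⊤ : SimpleGraph V).edgeSet → K) (p q : V) (a : K) : ℤ :=
  if (colourGraph c a).Adj p q then 1 else 0

theorem colourIndicator_comm (c : (⊤ : SimpleGraph V).edgeSet → K) (p q : V) (a : K) :
    colourIndicator c p q a = colourIndicator c q p a := by
  classical
  exact if_congr (SimpleGraph.adj_comm _ p q) rfl rfl

theorem colourIndicator_self (c : (⊤ : SimpleGraph V).edgeSet → K) (p : V) (a : K) :
    colourIndicator c p p a = 0 := by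
  simp [colourIndicator]

theorem colourIndicator_nonneg (c : (⊤ : SimpleGraph V).edgeSet → K) (p q : V) (a : K) :
    0 ≤ colourIndicator c p q a := by
  unfold colourIndicator
  split_ifs <;> simp

theorem colourIndicator_le_one (c : (⊤ : SimpleGraph V).edgeSet → K) (p q : V) (a : K) :
    colourIndicator c p q a ≤ 1 := by
  unfold colourIndicator
  split_ifs <;> simp

theorem sum_colourIndicator_of_ne [Fintype K] (c : (⊤ : SimpleGraph V).edgeSet → K) {p q : V}
    (h : p ≠ q) : ∑ a, colourIndicator c p q a = 1 := by
  classical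
  simp [colourIndicator, colourGraph_adj c _ h]

theorem sum_colourIndicator_le_one [Fintype K] (c : (⊤ : SimpleGraph V).edgeSet → K) (p q : V) :
    ∑ a, colourIndicator c p q a ≤ 1 := by
  by_cases h : p = q
  · simp [h, colourIndicator_self]
  · rw [sum_colourIndicator_of_ne c h]

/-- The handshake lemma for the graph of colour a. -/
theorem sum_sum_colourIndicator [Fintype V] (c : (⊤ : SimpleGraph V).edgeSet → K) (a : K) :
    ∑ p, ∑ q, colourIndicator c p q a = 2 * ((c ⁻¹' {a}).ncard : ℤ) := by
  classical
  have h1 : ∀ p, ∑ q, colourIndicator c p q a = ((colourGraph c a).degree p : ℤ) := by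
    intro p
    rw [← SimpleGraph.card_neighborFinset_eq_degree, SimpleGraph.neighborFinset_eq_filter]
    simp only [colourIndicator, Finset.sum_boole]
  have h2 : (colourGraph c a).edgeFinset.card = (c ⁻¹' {a}).ncard := by
    rw [← Set.ncard_coe_finset, SimpleGraph.coe_edgeFinset, colourGraph_edgeSet,
      Set.ncard_image_of_injective _ Subtype.val_injective]
  simp only [h1]
  rw [← h2]
  exact_mod_cast (colourGraph c a).sum_degrees_eq_twice_card_edges

theorem sum_sum_sum_colourIndicator [Fintype V] [Fintype K]
    (c : (⊤ : SimpleGraph V).edgeSet → K) :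
    ∑ a, ∑ p, ∑ q, colourIndicator c p q a = (Fintype.card V : ℤ) * (Fintype.card V - 1) := by
  classical
  have h1 : ∀ p q, ∑ a, colourIndicator c p q a = 1 - if p = q then 1 else 0 := by
    intro p q
    split_ifs with h
    · simp [h, colourIndicator_self]
    · simp [sum_colourIndicator_of_ne c h]
  have h2 : ∑ a, ∑ p, ∑ q, colourIndicator c p q a
      = ∑ p, ∑ q, ∑ a, colourIndicator c p q a := by
    rw [Finset.sum_comm]
    exact Finset.sum_congr rfl fun p _ => Finset.sum_comm
  rw [h2]
  simp [h1, mul_sub]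

/-- Every ordered pair of distinct vertices has exactly one colour, and balance gives all colours
the same share. -/
theorem IsColourBalanced.sum_sum_colourIndicator_mul_card [Fintype V] [Fintype K]
    {c : (⊤ : SimpleGraph V).edgeSet → K} (hc : IsColourBalanced c) (a : K) :
    (Fintype.card K : ℤ) * ∑ p, ∑ q, colourIndicator c p q a
      = (Fintype.card V : ℤ) * (Fintype.card V - 1) := by
  have h : ∀ b, ∑ p, ∑ q, colourIndicator c p q b = 2 * ((c ⁻¹' {a}).ncard : ℤ) := fun b => by
    rw [sum_sum_colourIndicator, hc b a]
  rw [← sum_sum_sum_colourIndicator c]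
  simp [h]

variable {I : Type*}

/-- The perfect matching with edges `π (i, false) π (i, true)`. -/
def labelledMatching (π : I × Bool ≃ V) : (⊤ : SimpleGraph V).Subgraph where
  verts := Set.univ
  Adj p q := p ≠ q ∧ (π.symm p).1 = (π.symm q).1
  adj_sub h := h.1
  edge_vert _ := Set.mem_univ _
  symm := ⟨fun _ _ h => ⟨h.1.symm, h.2.symm⟩⟩

theorem labelledMatching_adj_iff (π : I × Bool ≃ V) (i : I) (b : Bool) (q : V) :
    (labelledMatching π).Adj (π (i, b)) q ↔ q = π (i, !b) := by
  obtain ⟨⟨j, b'⟩, rfl⟩ := π.surjective q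
  simp only [labelledMatching, ne_eq, EmbeddingLike.apply_eq_iff_eq, Equiv.symm_apply_apply,
    Prod.mk.injEq]
  cases b <;> cases b' <;> simp [eq_comm]

theorem labelledMatching_isPerfectMatching (π : I × Bool ≃ V) :
    (labelledMatching π).IsPerfectMatching := by
  rw [SimpleGraph.Subgraph.isPerfectMatching_iff]
  intro p
  obtain ⟨⟨i, b⟩, rfl⟩ := π.surjective p
  simp only [labelledMatching_adj_iff]
  exact ⟨_, rfl, fun _ h => h⟩

theorem label_ne (π : I × Bool ≃ V) (i : I) : π (i, false) ≠ π (i, true) := by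
  simp

theorem colourCount_labelledMatching [Fintype I] (c : (⊤ : SimpleGraph V).edgeSet → K)
    (π : I × Bool ≃ V) (a : K) :
    (colourCount c (labelledMatching π) a : ℤ) = labelledCount (colourIndicator c) π a := by
  classical
  let F : I → (⊤ : SimpleGraph V).edgeSet := fun i =>
    ⟨s(π (i, false), π (i, true)), (SimpleGraph.mem_edgeSet _).2 (label_ne π i)⟩
  have hF : Function.Injective F := by
    intro i j h
    have h' : s(π (i, false), π (i, true)) = s(π (j, false), π (j, true)) :=
      congrArg Subtype.val h
    simp only [Sym2.eq_iff, EmbeddingLike.apply_eq_iff_eq, Prod.mk.injEq] at h'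
    rcases h' with h' | h'
    · exact h'.1.1
    · exact h'.1.1
  have hset : c ⁻¹' {a} ∩ {x | (x : Sym2 V) ∈ (labelledMatching π).edgeSet}
      = F '' {i | c (F i) = a} := by
    ext ⟨x, hx⟩
    constructor
    · rintro ⟨hca, hM⟩
      induction x using Sym2.ind with
      | _ p q =>
        obtain ⟨⟨i, b⟩, rfl⟩ := π.surjective p
        have hq : q = π (i, !b) := (labelledMatching_adj_iff π i b q).1
          (SimpleGraph.Subgraph.mem_edgeSet.1 hM)
        subst hq
        have hFi : F i = ⟨s(π (i, b), π (i, !b)), hx⟩ := by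
          apply Subtype.ext
          cases b
          · rfl
          · exact Sym2.eq_swap
        refine ⟨i, ?_, hFi⟩
        rw [Set.mem_ofPred_eq, hFi]
        exact hca
    · rintro ⟨i, hi, h⟩
      rw [← h]
      refine ⟨hi, ?_⟩
      exact SimpleGraph.Subgraph.mem_edgeSet.2 ((labelledMatching_adj_iff π i false _).2 rfl)
  rw [colourCount, hset, Set.ncard_image_of_injective _ hF, Set.ncard_eq_toFinset_card']
  simp only [labelledCount, colourIndicator, colourGraph_adj c a (label_ne π _), Finset.sum_boole]
  simp [F]

theorem sum_labelledCount_colourIndicator [Fintype I] [Fintype K]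
    (c : (⊤ : SimpleGraph V).edgeSet → K) (π : I × Bool ≃ V) :
    ∑ a, labelledCount (colourIndicator c) π a = Fintype.card I := by
  simp only [labelledCount]
  rw [Finset.sum_comm]
  simp [sum_colourIndicator_of_ne c (label_ne π _)]

theorem abs_switchEffect_colourIndicator_le (c : (⊤ : SimpleGraph V).edgeSet → K)
    (π : I × Bool ≃ V) (σ : I × I × Bool) (a : K) :
    |switchEffect (colourIndicator c) π σ a| ≤ 2 := by
  have h0 := fun p q => colourIndicator_nonneg c p q a
  have h1 := fun p q => colourIndicator_le_one c p q a
  have a1 := h0 (π (σ.1, false)) (π (σ.2.1, σ.2.2))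
  have a2 := h0 (π (σ.1, true)) (π (σ.2.1, !σ.2.2))
  have a3 := h0 (π (σ.1, false)) (π (σ.1, true))
  have a4 := h0 (π (σ.2.1, false)) (π (σ.2.1, true))
  have b1 := h1 (π (σ.1, false)) (π (σ.2.1, σ.2.2))
  have b2 := h1 (π (σ.1, true)) (π (σ.2.1, !σ.2.2))
  have b3 := h1 (π (σ.1, false)) (π (σ.1, true))
  have b4 := h1 (π (σ.2.1, false)) (π (σ.2.1, true))
  rw [abs_le]
  unfold switchEffect
  constructor <;> linarith

/-- Four vertex pairs are involved, each contributing to at most one colour. -/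
theorem sum_abs_switchEffect_colourIndicator_le [Fintype K]
    (c : (⊤ : SimpleGraph V).edgeSet → K) (π : I × Bool ≃ V) (σ : I × I × Bool) :
    ∑ a, |switchEffect (colourIndicator c) π σ a| ≤ 4 := by
  have h0 := fun p q a => colourIndicator_nonneg c p q a
  calc ∑ a, |switchEffect (colourIndicator c) π σ a|
      ≤ ∑ a, (colourIndicator c (π (σ.1, false)) (π (σ.2.1, σ.2.2)) a
        + colourIndicator c (π (σ.1, true)) (π (σ.2.1, !σ.2.2)) a
        + colourIndicator c (π (σ.1, false)) (π (σ.1, true)) a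
        + colourIndicator c (π (σ.2.1, false)) (π (σ.2.1, true)) a) := by
        refine Finset.sum_le_sum fun a _ => ?_
        have a1 := h0 (π (σ.1, false)) (π (σ.2.1, σ.2.2)) a
        have a2 := h0 (π (σ.1, true)) (π (σ.2.1, !σ.2.2)) a
        have a3 := h0 (π (σ.1, false)) (π (σ.1, true)) a
        have a4 := h0 (π (σ.2.1, false)) (π (σ.2.1, true)) a
        rw [abs_le]
        unfold switchEffect
        constructor <;> linarith
    _ ≤ 4 := by
        simp only [Finset.sum_add_distrib]
        linarith [sum_colourIndicator_le_one c (π (σ.1, false)) (π (σ.2.1, σ.2.2)),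
          sum_colourIndicator_le_one c (π (σ.1, true)) (π (σ.2.1, !σ.2.2)),
          sum_colourIndicator_le_one c (π (σ.1, false)) (π (σ.1, true)),
          sum_colourIndicator_le_one c (π (σ.2.1, false)) (π (σ.2.1, true))]

end Colouring

/-! ### Numerical estimate and conclusion -/

/-- The inequality fails for d = 1 (1920 against 256), so two colours need the sharper
one-dimensional bound. -/
theorem ninetySix_mul_le_four_pow {d : ℕ} (hd : 2 ≤ d) :
    96 * d ^ 2 * 20 ^ d ≤ 4 ^ ((d + 1) ^ 2) := by
  obtain ⟨e, rfl⟩ : ∃ e, d = e + 2 := ⟨d - 2, by omega⟩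
  have h1 : (e + 2) ^ 2 ≤ 4 ^ (e + 1) := by
    induction e with
    | zero => norm_num
    | succ e ih =>
      have := ih (by omega)
      rw [pow_succ 4]
      nlinarith
  have h2 : 20 ^ (e + 2) ≤ 400 * 4 ^ (3 * e) := by
    rw [pow_mul, pow_add]
    have : 20 ^ e ≤ (4 ^ 3) ^ e := Nat.pow_le_pow_left (by norm_num) e
    linarith
  calc 96 * (e + 2) ^ 2 * 20 ^ (e + 2) ≤ 96 * 4 ^ (e + 1) * (400 * 4 ^ (3 * e)) := by gcongr
    _ = 38400 * 4 ^ (4 * e + 1) := by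
        rw [show 4 * e + 1 = (e + 1) + 3 * e by ring, pow_add 4 (e + 1)]
        ring
    _ ≤ 4 ^ 8 * 4 ^ (4 * e + 1) := by gcongr; norm_num
    _ = 4 ^ (4 * e + 9) := by rw [← pow_add]; ring_nf
    _ ≤ 4 ^ ((e + 2 + 1) ^ 2) := by
        refine Nat.pow_le_pow_right (by norm_num) ?_
        nlinarith

theorem theorem2 (n k : ℕ) (hn : 0 < n) (hk : 0 < k)
    (c : (⊤ : SimpleGraph (Fin (2 * n * k))).edgeSet → Fin k) (hc : IsColourBalanced c) :
    ∃ M : (⊤ : SimpleGraph (Fin (2 * n * k))).Subgraph,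
      M.IsPerfectMatching ∧ matchingImbalance c n M ≤ (4 : ℤ) ^ (k ^ 2) := by
  classical
  obtain ⟨d, rfl⟩ : ∃ d, k = d + 1 := ⟨k - 1, by omega⟩
  have hm : 0 < n * (d + 1) := Nat.mul_pos hn hk
  have : Nonempty (Fin (n * (d + 1))) := ⟨⟨0, hm⟩⟩
  let e : Fin (2 * n * (d + 1)) → Fin (2 * n * (d + 1)) → Fin d → ℤ :=
    fun p q j => colourIndicator c p q j.castSucc
  have hsymm : ∀ p q j, e p q j = e q p j := fun p q j => colourIndicator_comm c p q _
  have hdiag : ∀ p j, e p p j = 0 := fun p j => colourIndicator_self c p _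
  have : Nonempty (Fin (n * (d + 1)) × Bool ≃ Fin (2 * n * (d + 1))) :=
    ⟨Fintype.equivOfCardEq (by simp; ring)⟩
  obtain ⟨π, hπ⟩ := Finite.exists_min
    (fun π : Fin (n * (d + 1)) × Bool ≃ Fin (2 * n * (d + 1)) =>
      ∑ j, |labelledCount e π j - (n : ℤ)|)
  set w : Fin d → ℤ := fun j => labelledCount e π j - (n : ℤ) with hw
  refine ⟨labelledMatching π, labelledMatching_isPerfectMatching π, ?_⟩
  have hsum : ∀ j, ∑ σ : Fin (n * (d + 1)) × Fin (n * (d + 1)) × Bool with σ.1 ≠ σ.2.1,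
      switchEffect e π σ j
        = -(2 * (2 * (Fintype.card (Fin (n * (d + 1))) : ℤ) - 1)) * w j := by
    intro j
    -- With this total, subtracting (4m - 2) times the count n + w j for m = n(d + 1) cancels every
    -- term free of w.
    have htot : ∑ p, ∑ q, e p q j = 2 * n * (2 * n * (d + 1) - 1) := by
      have h := hc.sum_sum_colourIndicator_mul_card j.castSucc
      rw [Fintype.card_fin, Fintype.card_fin] at h
      push_cast at h
      have hd0 : ((d : ℤ) + 1) ≠ 0 := by positivity
      refine mul_left_cancel₀ hd0 (h.trans ?_)
      ring
    rw [sum_switchEffect e hsymm hdiag, htot, Fintype.card_fin]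
    simp only [hw]
    push_cast
    ring
  have hmin : ∀ s : List (Fin (n * (d + 1)) × Fin (n * (d + 1)) × Bool), IsSwitchFamily s →
      ∑ j, |w j| ≤ ∑ j, |w j + (s.map (switchEffect e π)).sum j| := by
    intro s hs
    obtain ⟨π', -, hπ'⟩ := exists_labelledCount_switchFamily e hsymm π s hs
    refine (hπ π').trans (le_of_eq ?_)
    refine Finset.sum_congr rfl fun j _ => ?_
    rw [hπ']
    simp only [hw]
    congr 1
    ring
  have h2 : ∀ σ j, |switchEffect e π σ j| ≤ 2 :=
    fun σ j => abs_switchEffect_colourIndicator_le c π σ j.castSucc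
  have h4 : ∀ σ, ∑ j, |switchEffect e π σ j| ≤ 4 := by
    intro σ
    have h := sum_abs_switchEffect_colourIndicator_le c π σ
    rw [Fin.sum_univ_castSucc] at h
    have h0 := abs_nonneg (switchEffect (colourIndicator c) π σ (Fin.last d))
    have h1 : ∑ j, |switchEffect e π σ j|
        = ∑ j : Fin d, |switchEffect (colourIndicator c) π σ j.castSucc| := rfl
    linarith
  -- The deviations of all colours sum to 0, so the last one is at most ‖w‖₁ in absolute value.
  have himb : matchingImbalance c n (labelledMatching π) ≤ 2 * ∑ j, |w j| := by
    have hlast : labelledCount (colourIndicator c) π (Fin.last d) - (n : ℤ) = -∑ j, w j := by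
      have h := sum_labelledCount_colourIndicator c π
      rw [Fin.sum_univ_castSucc, Fintype.card_fin] at h
      have h1 : ∑ j, w j
          = ∑ j : Fin d, labelledCount (colourIndicator c) π j.castSucc - d * (n : ℤ) := by
        simp only [hw, Finset.sum_sub_distrib, Finset.sum_const, Finset.card_univ,
          Fintype.card_fin, nsmul_eq_mul]
        rfl
      push_cast at h
      rw [h1]
      linear_combination h
    simp only [matchingImbalance, colourCount_labelledMatching]
    rw [Fin.sum_univ_castSucc, hlast, abs_neg]
    have h3 : ∑ j : Fin d, |labelledCount (colourIndicator c) π j.castSucc - (n : ℤ)|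
        = ∑ j, |w j| := rfl
    have := Finset.abs_sum_le_sum_abs w univ
    linarith
  refine himb.trans ?_
  rcases lt_trichotomy d 1 with hd | rfl | hd
  · obtain rfl : d = 0 := by omega
    simp
  · have h1 := abs_le_one_of_switch_minimal (fun σ => switchEffect e π σ 0) (w 0)
      (fun σ => h2 σ 0) (hsum 0) (by
        intro σ hσ
        simpa using hmin [σ] ⟨by simpa using hσ, by simp⟩)
    simp only [Fin.sum_univ_one]
    norm_num
    linarith
  · have h1 := sum_abs_le_of_switch_minimal hd.le (switchEffect e π) w h4 h2 hsum hmin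
    have h3 : ((96 * d ^ 2 * 20 ^ d : ℕ) : ℤ) ≤ ((4 ^ ((d + 1) ^ 2) : ℕ) : ℤ) :=
      Nat.cast_le.2 (ninetySix_mul_le_four_pow hd)
    push_cast at h3
    linarith
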